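/- Let $K$ be a field of characteristic $0$, let $A=K\langle x_1,x_2,\ldots\rangle$ be the free unital associative algebra of countable rank and $A_2=K\langle x,y\rangle\subset A$ its subalgebra generated by $x=x_1$, $y=x_2$. Let $SJ\subset A$ be the free special Jordan algebra with unit, i.e. the smallest subspace of $A$ that contains $1$ and all $x_i$ and is closed under $a\circ b=ab+ba$. Write $[a,b]=ab-ba$, and $v(\mathrm{ad}\,z)=[v,z]$ (operators act from the right). Let $T$ be the weak T-ideal generated by the standard polynomial $S_4(x_1,x_2,x_3,x_4)=\sum_{\sigma\in \mathrm{Sym}(4)}\mathrm{sign}(\sigma)\,x_{\sigma(1)}x_{\sigma(2)}x_{\sigma(3)}x_{\sigma(4)}$ and the metabelian polynomial $[[x_1,x_2],[x_3,x_4]]$, i.e. the two-sided ideal of $A$ generated by all $S_4(u_1,u_2,u_3,u_4)$ and $[[u_1,u_2],[u_3,u_4]]$ with $u_1,u_2,u_3,u_4\in SJ$. Let $F_2=A_2/(A_2\cap T)$. Let $B_2\subset A_2$ be the space of proper polynomials, i.e. the span of all products (including the empty product $1$) of left-normed commutators $[z_1,z_2,\ldots,z_r]=[\ldots[[z_1,z_2],z_3],\ldots,z_r]$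 with $r\ge 2$ and $z_i\in\{x,y\}$, and let $\widetilde B_2$ be the image of $B_2$ in $F_2$. Then the vector space $\widetilde B_2$ is spanned by $1$ together with the (images of the) elements $$([y,x](\mathrm{ad}\,x)^k(\mathrm{ad}\,y)^l)\,[y,x]^{q-1},\qquad k,l\ge 0,\quad q\ge 1.$$ -/

import Mathlib

noncomputable section

namespace WeakId

/-- The free unital associative algebra `A_m = K⟨x_1, …, x_m⟩`; the generators are indexed by
`Fin m`, from `0`. -/
abbrev A (K : Type*) [Field K] (m : ℕ) := FreeAlgebra K (Fin m)

/-- The free unital associative algebra `A = A_∞` of countable rank. -/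
abbrev AInf (K : Type*) [Field K] := FreeAlgebra K ℕ

/-- The generators of `A_m`. -/
abbrev X (K : Type*) [Field K] {m : ℕ} (i : Fin m) : A K m := FreeAlgebra.ι K i

/-- The generators of `A_∞`. -/
abbrev XInf (K : Type*) [Field K] (i : ℕ) : AInf K := FreeAlgebra.ι K i

/-- The natural embedding `A_m → A_∞`. -/
def incl (K : Type*) [Field K] (m : ℕ) : A K m →ₐ[K] AInf K :=
  FreeAlgebra.lift K (fun i : Fin m => XInf K (i : ℕ))

/-- The commutator `[a, b] = ab - ba`. -/
def comm {R : Type*} [Ring R] (a b : R) : R := a * b - b * a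

/-- The Jordan product `a ∘ b = ab + ba`. -/
def jordan {R : Type*} [Ring R] (a b : R) : R := a * b + b * a

/-- The unital free special Jordan algebra `SJ = SJ_∞`: the smallest subspace of `A_∞` that
contains `1` and the generators and is closed under `∘`. -/
def SJ (K : Type*) [Field K] : Submodule K (AInf K) :=
  sInf {S | 1 ∈ S ∧ (∀ i, XInf K i ∈ S) ∧ ∀ a ∈ S, ∀ b ∈ S, jordan a b ∈ S}

/-- The weak T-ideal generated by a set `E` of polynomials: the two-sided ideal of `A_∞`
generated by all `f(u_1, u_2, …)` with `f ∈ E` and all `u_j ∈ SJ`. -/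
def weakTIdeal (K : Type*) [Field K] (E : Set (AInf K)) : TwoSidedIdeal (AInf K) :=
  TwoSidedIdeal.span
    {g | ∃ f ∈ E, ∃ u : ℕ → AInf K, (∀ j, u j ∈ SJ K) ∧ g = FreeAlgebra.lift K u f}

/-- The standard polynomial `S_4 = ∑ sign(σ) x_{σ(1)} x_{σ(2)} x_{σ(3)} x_{σ(4)}`. -/
def S4 (K : Type*) [Field K] : AInf K :=
  ∑ σ : Equiv.Perm (Fin 4), ((Equiv.Perm.sign σ : ℤ) : AInf K) *
    (XInf K (σ 0) * XInf K (σ 1) * XInf K (σ 2) * XInf K (σ 3))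

/-- The metabelian polynomial `[[x_1, x_2], [x_3, x_4]]`. -/
def metab (K : Type*) [Field K] : AInf K :=
  comm (comm (XInf K 0) (XInf K 1)) (comm (XInf K 2) (XInf K 3))

/-- The weak T-ideal `T` generated by `S_4` and the metabelian polynomial. -/
def T (K : Type*) [Field K] : TwoSidedIdeal (AInf K) := weakTIdeal K {S4 K, metab K}

/-- The ideal `A_m ∩ T` of `A_m`. -/
def Tm (K : Type*) [Field K] (m : ℕ) : TwoSidedIdeal (A K m) :=
  TwoSidedIdeal.comap (incl K m) (T K)

/-- The relatively free algebra `F_m = A_m / (A_m ∩ T)`. -/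
abbrev F (K : Type*) [Field K] (m : ℕ) := (Tm K m).ringCon.Quotient

/-- The canonical homomorphism `A_m → F_m`. -/
def proj (K : Type*) [Field K] (m : ℕ) : A K m →ₐ[K] F K m := (Tm K m).ringCon.mkₐ (α := K)

/-- The left-normed commutator `[a_1, a_2, …, a_r] = [… [[a_1, a_2], a_3], …, a_r]`. -/
def leftNormed {R : Type*} [Ring R] : List R → R
  | [] => 0
  | a :: l => l.foldl comm a

/-- `B_m^{(n)}`: the span in `A_m` of the products of left-normed commutators of generators, each
commutator of length at least `2`, of total degree `n`. The empty product `1` is allowed. -/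
def Bdeg (K : Type*) [Field K] (m n : ℕ) : Submodule K (A K m) :=
  Submodule.span K {w | ∃ L : List (List (Fin m)), (∀ c ∈ L, 2 ≤ c.length) ∧
    (L.map List.length).sum = n ∧ w = (L.map fun c => leftNormed (c.map (X K))).prod}

/-- The space `B_m = ∑_{n ≥ 0} B_m^{(n)}` of proper polynomials in `m` variables. -/
def B (K : Type*) [Field K] (m : ℕ) : Submodule K (A K m) := ⨆ n : ℕ, Bdeg K m n

/-- The image of `B_m` in `F_m`. -/
def Btilde (K : Type*) [Field K] (m : ℕ) : Submodule K (F K m) :=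
  (B K m).map (proj K m).toLinearMap

/-- The right-acting operator `ad z : v ↦ [v, z]`. -/
def ad {R : Type*} [Ring R] (z v : R) : R := comm v z

/-- The element `([y, x] (ad x)^k (ad y)^l) [y, x]^{q - 1}`; the operators act from the right, so
`(ad x)^k` is applied first. It is used for `q ≥ 1` only. -/
def elt {R : Type*} [Ring R] (x y : R) (k l q : ℕ) : R :=
  (ad y)^[l] ((ad x)^[k] (comm y x)) * comm y x ^ (q - 1)

end WeakId

end

/-! Write `c = [y, x]` in `F_2` and let `J` be the image of `SJ ∩ A_2`. The metabelian identity
makes the elements of `[J, J]` commute with each other, so `S_4` becomes a Plücker relation between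
commutators. Applied to Jordan products, the metabelian identity also shows that `c` anticommutes
with `[d, x]` and `[d, y]` for every commutator `d` of two elements of `J`. Hence `c²` is central,
and so is `dc` for `d = [a, x]` or `[a, y]` with `a ∈ J`. For such `d`, Plücker relations with
arguments of degree two and three rewrite `[d, z][c, w]`, `z, w ∈ {x, y}`, as an element times `c`
(`isReducible_comm_x`).

These rules make the span of the elements `[y, x] (ad x)^k (ad y)^l c^j` stable under `ad x` and `ad
y` (`comm_x_mem`, `comm_y_mem`). It is visibly stable under right multiplication by `c`, hence by
the Leibniz rule under right multiplication by every long commutator in `x, y`. Multiplying up from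
`1` reaches all proper polynomials. -/

namespace WeakId

/-! ### Consequences of the two identities on a Jordan-closed subspace -/

section Pair

variable {K R : Type*} [Field K] [Ring R] [Algebra K R]

/-- A Jordan-closed subspace `J` of an associative algebra on which the metabelian polynomial and
`S₄` (written through commutators) vanish, with two elements `x, y ∈ J` such that whatever commutes
with both is central. -/
structure IsWeakPair (J : Submodule K R) (x y : R) : Prop where
  mem_x : x ∈ J
  mem_y : y ∈ J
  jordan_mem : ∀ a ∈ J, ∀ b ∈ J, jordan a b ∈ J
  metab : ∀ a ∈ J, ∀ b ∈ J, ∀ c ∈ J, ∀ d ∈ J, comm (comm a b) (comm c d) = 0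
  s4 : ∀ a ∈ J, ∀ b ∈ J, ∀ c ∈ J, ∀ d ∈ J,
    jordan (comm a b) (comm c d) - jordan (comm a c) (comm b d) +
      jordan (comm a d) (comm b c) = 0
  central : ∀ z, z * x = x * z → z * y = y * z → ∀ r, z * r = r * z

theorem eq_zero_of_add_self (K : Type*) {R : Type*} [Field K] [CharZero K] [Ring R] [Algebra K R]
    {r : R} (h : r + r = 0) : r = 0 := by
  rw [← two_smul K r] at h
  exact (smul_eq_zero.mp h).resolve_left two_ne_zero

namespace IsWeakPair

variable {J : Submodule K R} {x y : R}

theorem symm (h : IsWeakPair J x y) : IsWeakPair J y x :=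
  ⟨h.mem_y, h.mem_x, h.jordan_mem, h.metab, h.s4, fun z hy hx => h.central z hx hy⟩

theorem comm_mul_comm (h : IsWeakPair J x y) {a b c d : R} (ha : a ∈ J) (hb : b ∈ J)
    (hc : c ∈ J) (hd : d ∈ J) : comm a b * comm c d = comm c d * comm a b :=
  sub_eq_zero.mp (h.metab a ha b hb c hc d hd)

theorem comm_comm_mem (h : IsWeakPair J x y) {a b c : R} (ha : a ∈ J) (hb : b ∈ J)
    (hc : c ∈ J) : comm (comm a b) c ∈ J := by
  have : comm (comm a b) c = jordan a (jordan b c) - jordan b (jordan a c) := by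
    unfold comm jordan; noncomm_ring
  rw [this]
  exact J.sub_mem (h.jordan_mem a ha _ (h.jordan_mem b hb c hc))
    (h.jordan_mem b hb _ (h.jordan_mem a ha c hc))

/-- `[a, b] ∘ [d, c]` is skew-symmetric in `b, c` for `d ∈ [J, J]`. -/
theorem jordan_comm_add (h : IsWeakPair J x y) {p q a b c : R} (hp : p ∈ J) (hq : q ∈ J)
    (ha : a ∈ J) (hb : b ∈ J) (hc : c ∈ J) :
    jordan (comm a b) (comm (comm p q) c) + jordan (comm a c) (comm (comm p q) b) = 0 := by
  -- Since `[p, q]` commutes with `[a, b]` and `[a, c]`, expanding its commutator with `[a, b ∘ c]`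
  -- leaves only the two terms of the claim.
  have h1 := h.comm_mul_comm hp hq ha (h.jordan_mem b hb c hc)
  have h2 := h.comm_mul_comm hp hq ha hb
  have h3 := h.comm_mul_comm hp hq ha hc
  have h4 : comm a (jordan b c) = jordan (comm a b) c + jordan (comm a c) b := by
    unfold comm jordan; noncomm_ring
  rw [h4] at h1
  generalize comm p q = d at *
  generalize comm a b = e at *
  generalize comm a c = f at *
  unfold comm jordan at *
  linear_combination (norm := noncomm_ring) h1 - h2 * c - c * h2 - h3 * b - b * h3

variable [CharZero K]

/-- Commutators of elements of `J` commute, so each Jordan product in `S_4` is twice an ordinary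
product. -/
theorem plucker (h : IsWeakPair J x y) {a b c d : R} (ha : a ∈ J) (hb : b ∈ J)
    (hc : c ∈ J) (hd : d ∈ J) :
    comm a b * comm c d - comm a c * comm b d + comm a d * comm b c = 0 := by
  apply eq_zero_of_add_self K
  have h1 := h.comm_mul_comm ha hb hc hd
  have h2 := h.comm_mul_comm ha hc hb hd
  have h3 := h.comm_mul_comm ha hd hb hc
  have h4 := h.s4 a ha b hb c hc d hd
  unfold jordan at h4
  rw [← h1, ← h2, ← h3] at h4
  rw [← h4]
  abel

theorem sq_mem (h : IsWeakPair J x y) {a : R} (ha : a ∈ J) : a * a ∈ J := by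
  have h1 := J.smul_mem (2⁻¹ : K) (h.jordan_mem a ha a ha)
  rwa [jordan, ← two_smul K, smul_smul, inv_mul_cancel₀ two_ne_zero, one_smul] at h1

theorem mul_mul_mem (h : IsWeakPair J x y) {a b : R} (ha : a ∈ J) (hb : b ∈ J) :
    a * b * a ∈ J := by
  have h1 := J.smul_mem (2⁻¹ : K) (J.sub_mem (h.jordan_mem a ha _ (h.jordan_mem a ha b hb))
    (h.jordan_mem _ (h.sq_mem ha) b hb))
  have h2 : jordan a (jordan a b) - jordan (a * a) b = (2 : K) • (a * b * a) := by
    rw [two_smul]; unfold jordan; noncomm_ring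
  rwa [h2, smul_smul, inv_mul_cancel₀ two_ne_zero, one_smul] at h1

theorem jordan_comm_self (h : IsWeakPair J x y) {p q a b : R} (hp : p ∈ J) (hq : q ∈ J)
    (ha : a ∈ J) (hb : b ∈ J) : jordan (comm a b) (comm (comm p q) b) = 0 :=
  eq_zero_of_add_self K (h.jordan_comm_add hp hq ha hb hb)

theorem jordan_base_x (h : IsWeakPair J x y) {p q : R} (hp : p ∈ J) (hq : q ∈ J) :
    jordan (comm y x) (comm (comm p q) x) = 0 :=
  h.jordan_comm_self hp hq h.mem_y h.mem_x

theorem jordan_base_y (h : IsWeakPair J x y) {p q : R} (hp : p ∈ J) (hq : q ∈ J) :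
    jordan (comm y x) (comm (comm p q) y) = 0 := by
  have h1 := h.symm.jordan_base_x hp hq
  generalize comm (comm p q) y = r at *
  unfold comm jordan at *
  linear_combination (norm := noncomm_ring) -h1

/-- For `c = [y, x]`, `[c², z] = c ∘ [c, z]`, which vanishes for `z = x, y`. -/
theorem sq_central (h : IsWeakPair J x y) (r : R) :
    comm y x * comm y x * r = r * (comm y x * comm y x) := by
  have h1 := h.jordan_base_x h.mem_y h.mem_x
  have h2 := h.jordan_base_y h.mem_y h.mem_x
  generalize comm y x = c at *
  unfold comm jordan at *
  apply h.central
  · linear_combination (norm := noncomm_ring) h1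
  · linear_combination (norm := noncomm_ring) h2

/-- With `d = [a, x]` and `c = [y, x]` commuting, `2[dc, z] = d ∘ [c, z] + c ∘ [d, z]`, and both
summands vanish for `z = x, y`. -/
theorem comm_x_mul_central (h : IsWeakPair J x y) {a : R} (ha : a ∈ J) (r : R) :
    comm a x * comm y x * r = r * (comm a x * comm y x) := by
  have hc := h.comm_mul_comm ha h.mem_x h.mem_y h.mem_x
  have h1 := h.jordan_comm_self h.mem_y h.mem_x ha h.mem_x
  have h2 := h.jordan_base_x ha h.mem_x
  have h3 := h.jordan_base_y ha h.mem_x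
  have h4 : jordan (comm a x) (comm (comm y x) y) = 0 := by
    -- Skew-symmetry trades `[x, a] ∘ [c, y]` for `[x, y] ∘ [c, a] = -[c², a]`, which is zero as
    -- `c²` is central.
    have h5 := h.jordan_comm_add h.mem_y h.mem_x h.mem_x ha h.mem_y
    have h6 := h.sq_central a
    have e1 : comm x a = - comm a x := by unfold comm; noncomm_ring
    have e2 : comm x y = - comm y x := by unfold comm; noncomm_ring
    rw [e1, e2] at h5
    generalize comm y x = c at *
    generalize comm a x = d at *
    unfold comm jordan at *
    linear_combination (norm := noncomm_ring) -h5 - h6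
  generalize comm y x = c at *
  generalize comm a x = d at *
  unfold comm jordan at *
  apply h.central
  · rw [← sub_eq_zero]
    apply eq_zero_of_add_self K
    linear_combination (norm := noncomm_ring) h1 + h2 + hc * x - x * hc
  · rw [← sub_eq_zero]
    apply eq_zero_of_add_self K
    linear_combination (norm := noncomm_ring) h4 + h3 + hc * y - y * hc

theorem comm_y_mul_central (h : IsWeakPair J x y) {a : R} (ha : a ∈ J) (r : R) :
    comm a y * comm y x * r = r * (comm a y * comm y x) := by
  have h1 := h.symm.comm_x_mul_central ha r
  have e2 : comm x y = - comm y x := by unfold comm; noncomm_ring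
  rw [e2] at h1
  simpa using h1

end IsWeakPair

/-- The identities that allow one to rewrite products `[d, z][c, w]`, for `c = [y, x]` and
`z, w ∈ {x, y}`. -/
structure IsReducible (x y d : R) : Prop where
  comm_base : d * comm y x = comm y x * d
  central : ∀ r, d * comm y x * r = r * (d * comm y x)
  jordan_x : jordan (comm y x) (comm d x) = 0
  jordan_y : jordan (comm y x) (comm d y) = 0
  mul_xx : comm d x * comm (comm y x) x = - (comm (comm d x) x * comm y x)
  mul_yy : comm d y * comm (comm y x) y = - (comm (comm d y) y * comm y x)
  mul_xy : comm d x * comm (comm y x) y =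
    2 * (d * comm y x * comm y x) - comm (comm d x) y * comm y x
  mul_yx : comm d y * comm (comm y x) x =
    - 2 * (d * comm y x * comm y x) - comm (comm d x) y * comm y x

theorem IsReducible.symm {x y d : R} (h : IsReducible y x d) : IsReducible x y d := by
  obtain ⟨h1, h2, h3, h4, h5, h6, h7, h8⟩ := h
  -- Exchanging `x` and `y` changes the sign of `c`; the two mixed second commutators of `d` agree
  -- because `d` commutes with `c`.
  have e2 : comm x y = - comm y x := by unfold comm; noncomm_ring
  rw [e2] at h1 h2 h3 h4 h5 h6 h7 h8
  have e3 : comm (comm d y) x = comm (comm d x) y := by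
    unfold comm at *
    linear_combination (norm := noncomm_ring) -h1
  rw [e3] at h7 h8
  have e4 : ∀ r : R, comm (-comm y x) r = - comm (comm y x) r := by
    intro r; unfold comm; noncomm_ring
  simp only [e4] at h5 h6 h7 h8
  have e5 : ∀ r : R, jordan (-comm y x) r = - jordan (comm y x) r := by
    intro r; unfold jordan; noncomm_ring
  rw [e5, neg_eq_zero] at h3 h4
  refine ⟨by simpa using h1, by simpa using h2, h4, h3, ?_, ?_, ?_, ?_⟩
  · linear_combination (norm := noncomm_ring) -h6
  · linear_combination (norm := noncomm_ring) -h5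
  · linear_combination (norm := noncomm_ring) -h8
  · linear_combination (norm := noncomm_ring) -h7

namespace IsWeakPair

variable [CharZero K] {J : Submodule K R} {x y : R}

theorem isReducible_comm_x (h : IsWeakPair J x y) {a : R} (ha : a ∈ J) :
    IsReducible x y (comm a x) := by
  have hx := h.mem_x
  have hy := h.mem_y
  have hc := h.comm_mul_comm ha hx hy hx
  have hf := h.comm_mul_comm ha hy hy hx
  have hdr := h.comm_x_mul_central ha
  have hfr := h.comm_y_mul_central ha
  have j1 := h.jordan_base_x ha hx
  have j2 := h.jordan_base_y ha hx
  -- The Plücker relation is taken at `(a, x, y, x³)`, `(a, x, y, yxy)`, `(a, x, y, x² ∘ y)` and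
  -- `(a, x, x², y²)`. The first two give `mul_xx` and `mul_yy`, the last gives `mul_yx`, and the
  -- last two together give `mul_xy`.
  have s1 := h.plucker ha hx hy (h.mul_mul_mem hx hx)
  have s2 := h.plucker ha hx hy (h.mul_mul_mem hy hx)
  have s3 := h.plucker ha hx hy (h.jordan_mem _ (h.sq_mem hx) _ hy)
  have s4 := h.plucker ha hx (h.sq_mem hx) (h.sq_mem hy)
  have t1 : comm a x * (x * x * comm y x + x * comm y x * x + comm y x * x * x) =
      (x * x * comm a x + x * comm a x * x + comm a x * x * x) * comm y x := by
    rw [← sub_eq_zero, ← s1]; unfold comm; noncomm_ring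
  have t2 : comm a x * y * comm y x * y + comm a y * (comm y x * x * y + y * x * comm y x) =
      (comm a y * x * y + y * comm a x * y + y * x * comm a y) * comm y x := by
    rw [← sub_eq_zero, ← s2]; unfold comm; noncomm_ring
  have t3 : comm a x * jordan (jordan (comm y x) x) y
      + comm a y * (x * x * comm y x + comm y x * x * x) =
      (jordan (jordan (comm a x) x) y + x * x * comm a y + comm a y * x * x) * comm y x := by
    rw [← sub_eq_zero, ← s3]; unfold comm jordan; noncomm_ring
  have t4 : comm a x * jordan (jordan (comm y x) x) y =
      jordan (comm a x) x * jordan (comm y x) y := by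
    rw [← sub_eq_zero, ← neg_eq_zero, ← s4]; unfold comm jordan; noncomm_ring
  have hyx : y * x = x * y + comm y x := by unfold comm; noncomm_ring
  clear s1 s2 s3 s4
  have dx := hdr x
  have dy := hdr y
  have dxy := hdr (x * y)
  have fxy := hfr (x * y)
  have fxx := hfr (x * x)
  refine ⟨hc, hdr, j1, j2, ?_, ?_, ?_, ?_⟩
  all_goals
    generalize comm y x = c at *
    generalize comm a x = d at *
    generalize comm a y = f at *
    unfold comm jordan at *
  · linear_combination (norm := noncomm_ring) t1 - dx * x - 2 * x * dx
  · linear_combination (norm := noncomm_ring)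
      t2 - fxy + hyx * f * c - f * hyx * c - hf * c - y * dy
  · linear_combination (norm := noncomm_ring)
      t3 - fxx - dxy + hyx * d * c - d * hyx * c - hc * c - t4 + d * hyx * c + dx * y - x * dy
        + hyx * d * c - hc * c
  · linear_combination (norm := noncomm_ring) t4 - 2 * d * hyx * c - dx * y - y * dx

theorem isReducible_comm_y (h : IsWeakPair J x y) {a : R} (ha : a ∈ J) :
    IsReducible x y (comm a y) :=
  (h.symm.isReducible_comm_x ha).symm

theorem isReducible_base (h : IsWeakPair J x y) : IsReducible x y (comm y x) :=
  h.isReducible_comm_x h.mem_y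

end IsWeakPair
end Pair

/-! ### Stability of the span of the reduced elements -/

section Reduced

variable {K R : Type*} [Field K] [Ring R] [Algebra K R]

theorem comm_mul_left (a b z : R) : comm (a * b) z = comm a z * b + a * comm b z := by
  unfold comm; noncomm_ring

theorem comm_comm_swap (u x y : R) :
    comm (comm u y) x = comm (comm u x) y + comm u (comm y x) := by
  unfold comm; noncomm_ring

theorem comm_eq_zero {a b : R} (h : a * b = b * a) : comm a b = 0 := sub_eq_zero.mpr h

theorem IsReducible.comm_x_mul {x y d : R} (h : IsReducible x y d) :
    comm (comm d x * comm y x) x = 0 ∧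
      comm (comm d x * comm y x) y = 2 * (d * comm y x * comm y x) := by
  rw [comm_mul_left, comm_mul_left, h.mul_xx, h.mul_xy]
  exact ⟨by abel, by abel⟩

theorem IsReducible.comm_y_mul {x y d : R} (h : IsReducible x y d) :
    comm (comm d y * comm y x) y = 0 ∧
      comm (comm d y * comm y x) x = -2 * (d * comm y x * comm y x) := by
  rw [comm_mul_left, comm_mul_left, h.mul_yy, h.mul_yx, comm_comm_swap d x y,
    comm_eq_zero h.comm_base, add_zero]
  exact ⟨by abel, by abel⟩

/-- The commutator `[y, x] (ad x)^k (ad y)^l`. -/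
def baseComm (x y : R) (k l : ℕ) : R := (ad y)^[l] ((ad x)^[k] (comm y x))

theorem baseComm_succ_right (x y : R) (k l : ℕ) :
    baseComm x y k (l + 1) = comm (baseComm x y k l) y := by
  simp [baseComm, Function.iterate_succ_apply', ad]

theorem baseComm_succ_zero (x y : R) (k : ℕ) :
    baseComm x y (k + 1) 0 = comm (baseComm x y k 0) x := by
  simp [baseComm, Function.iterate_succ_apply', ad]

variable (K) in
/-- The span of the elements `([y, x] (ad x)^k (ad y)^l) [y, x]^j`. -/
def reducedSpan (x y : R) : Submodule K R :=
  Submodule.span K {f | ∃ k l j : ℕ, f = baseComm x y k l * comm y x ^ j}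

theorem baseComm_mul_pow_mem (x y : R) (k l j : ℕ) :
    baseComm x y k l * comm y x ^ j ∈ reducedSpan K x y :=
  Submodule.subset_span ⟨k, l, j, rfl⟩

theorem baseComm_mem (x y : R) (k l : ℕ) : baseComm x y k l ∈ reducedSpan K x y := by
  simpa using baseComm_mul_pow_mem (K := K) x y k l 0

theorem mul_base_mem {x y w : R} (hw : w ∈ reducedSpan K x y) :
    w * comm y x ∈ reducedSpan K x y := by
  induction hw using Submodule.span_induction with
  | mem f hf =>
    obtain ⟨k, l, j, rfl⟩ := hf
    rw [mul_assoc, ← pow_succ]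
    exact baseComm_mul_pow_mem x y k l (j + 1)
  | zero => simp
  | add a b _ _ ha hb => rw [add_mul]; exact add_mem ha hb
  | smul t a _ ha => rw [smul_mul_assoc]; exact Submodule.smul_mem _ t ha

theorem mul_base_pow_mem {x y w : R} (hw : w ∈ reducedSpan K x y) (j : ℕ) :
    w * comm y x ^ j ∈ reducedSpan K x y := by
  induction j with
  | zero => simpa
  | succ j ih => rw [pow_succ, ← mul_assoc]; exact mul_base_mem ih

theorem comm_mem_of_generators {x y z : R}
    (h : ∀ k l j, comm (baseComm x y k l * comm y x ^ j) z ∈ reducedSpan K x y)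
    {w : R} (hw : w ∈ reducedSpan K x y) : comm w z ∈ reducedSpan K x y := by
  induction hw using Submodule.span_induction with
  | mem f hf => obtain ⟨k, l, j, rfl⟩ := hf; exact h k l j
  | zero => simp [comm]
  | add a b _ _ ha hb =>
    have : comm (a + b) z = comm a z + comm b z := by unfold comm; noncomm_ring
    rw [this]; exact add_mem ha hb
  | smul t a _ ha =>
    have : comm (t • a) z = t • comm a z := by simp [comm, smul_sub]
    rw [this]; exact Submodule.smul_mem _ t ha

theorem two_mul_mem {S : Submodule K R} {r : R} (h : r ∈ S) : 2 * r ∈ S := by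
  rw [two_mul]; exact add_mem h h

namespace IsWeakPair

variable [CharZero K] {J : Submodule K R} {x y : R}

theorem base_pow_even (h : IsWeakPair J x y) (i : ℕ) (r : R) :
    comm y x ^ (i + i) * r = r * comm y x ^ (i + i) := by
  have h1 : Commute (comm y x * comm y x) r := h.sq_central r
  have h2 := h1.pow_left i
  rw [← pow_two, ← pow_mul, two_mul] at h2
  exact h2

/-- Bracketing with `x` or `y` alternates between `[J, J]` and `J`, because `[[J, J], J] ⊆ J`. The
odd case also records the preceding even commutator `d`, to which the rewriting rules apply. -/
theorem baseComm_parity (h : IsWeakPair J x y) (k l : ℕ) :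
    (Even (k + l) → IsReducible x y (baseComm x y k l) ∧
      ∃ a ∈ J, ∃ b ∈ J, baseComm x y k l = comm a b) ∧
    (¬ Even (k + l) → baseComm x y k l ∈ J ∧
      ∃ d, IsReducible x y d ∧ d ∈ reducedSpan K x y ∧
        (baseComm x y k l = comm d x ∨ baseComm x y k l = comm d y)) := by
  induction l with
  | succ l ih =>
    rw [← add_assoc, Nat.even_add_one, not_not, baseComm_succ_right]
    refine ⟨fun he => ?_, fun he => ?_⟩
    · exact ⟨h.isReducible_comm_y (ih.2 he).1, _, (ih.2 he).1, y, h.mem_y, rfl⟩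
    · obtain ⟨hr, a, ha, b, hb, hab⟩ := ih.1 he
      exact ⟨hab ▸ h.comm_comm_mem ha hb h.mem_y, _, hr, baseComm_mem x y k l, Or.inr rfl⟩
  | zero =>
    simp only [add_zero]
    induction k with
    | zero =>
      exact ⟨fun _ => ⟨h.isReducible_base, y, h.mem_y, x, h.mem_x, rfl⟩, fun h0 => by simp at h0⟩
    | succ k ih =>
      rw [Nat.even_add_one, not_not, baseComm_succ_zero]
      refine ⟨fun he => ?_, fun he => ?_⟩
      · exact ⟨h.isReducible_comm_x (ih.2 he).1, _, (ih.2 he).1, x, h.mem_x, rfl⟩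
      · obtain ⟨hr, a, ha, b, hb, hab⟩ := ih.1 he
        exact ⟨hab ▸ h.comm_comm_mem ha hb h.mem_x, _, hr, baseComm_mem x y k 0, Or.inl rfl⟩

theorem comm_baseComm_mul_base_mem (h : IsWeakPair J x y) (k l : ℕ) :
    comm (baseComm x y k l * comm y x) x ∈ reducedSpan K x y ∧
      comm (baseComm x y k l * comm y x) y ∈ reducedSpan K x y := by
  by_cases he : Even (k + l)
  · have hr := ((h.baseComm_parity k l).1 he).1.central
    rw [comm_eq_zero (hr x), comm_eq_zero (hr y)]
    exact ⟨zero_mem _, zero_mem _⟩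
  · obtain ⟨-, d, hd, hdm, hx | hy⟩ := (h.baseComm_parity k l).2 he
    · rw [hx, hd.comm_x_mul.1, hd.comm_x_mul.2]
      exact ⟨zero_mem _, two_mul_mem (mul_base_mem (mul_base_mem hdm))⟩
    · rw [hy, hd.comm_y_mul.1, hd.comm_y_mul.2, neg_mul]
      exact ⟨neg_mem (two_mul_mem (mul_base_mem (mul_base_mem hdm))), zero_mem _⟩

/-- As `c²` is central, only the exponents `0` and `1` of `c` need to be checked. -/
theorem comm_generator_mem (h : IsWeakPair J x y) {z : R} (k l j : ℕ)
    (h0 : comm (baseComm x y k l) z ∈ reducedSpan K x y)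
    (h1 : comm (baseComm x y k l * comm y x) z ∈ reducedSpan K x y) :
    comm (baseComm x y k l * comm y x ^ j) z ∈ reducedSpan K x y := by
  rcases Nat.even_or_odd' j with ⟨i, rfl | rfl⟩
  · rw [two_mul, comm_mul_left, comm_eq_zero (h.base_pow_even i z), mul_zero, add_zero]
    exact mul_base_pow_mem h0 _
  · rw [two_mul, pow_succ', ← mul_assoc, comm_mul_left, comm_eq_zero (h.base_pow_even i z),
      mul_zero, add_zero]
    exact mul_base_pow_mem h1 _

theorem comm_y_mem (h : IsWeakPair J x y) {w : R} (hw : w ∈ reducedSpan K x y) :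
    comm w y ∈ reducedSpan K x y := by
  refine comm_mem_of_generators (fun k l j => h.comm_generator_mem k l j ?_
    (h.comm_baseComm_mul_base_mem k l).2) hw
  rw [← baseComm_succ_right]
  exact baseComm_mem x y k (l + 1)

/-- Moving `ad x` past `ad y` costs `[u, c]`, which is `0` when `u` commutes with `c` (even case)
and `2uc` when they anticommute (odd case). -/
theorem comm_baseComm_x_mem (h : IsWeakPair J x y) (k l : ℕ) :
    comm (baseComm x y k l) x ∈ reducedSpan K x y := by
  induction l with
  | zero => rw [← baseComm_succ_zero]; exact baseComm_mem x y (k + 1) 0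
  | succ l ih =>
    rw [baseComm_succ_right, comm_comm_swap]
    refine add_mem (h.comm_y_mem ih) ?_
    by_cases he : Even (k + l)
    · rw [comm_eq_zero ((h.baseComm_parity k l).1 he).1.comm_base]
      exact zero_mem _
    · have hj : jordan (comm y x) (baseComm x y k l) = 0 := by
        obtain ⟨-, d, hd, -, hx | hy⟩ := (h.baseComm_parity k l).2 he
        · rw [hx]; exact hd.jordan_x
        · rw [hy]; exact hd.jordan_y
      have : comm (baseComm x y k l) (comm y x) = 2 * (baseComm x y k l * comm y x) := by
        generalize baseComm x y k l = u at *
        generalize comm y x = c at *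
        unfold jordan at hj
        unfold comm
        linear_combination (norm := noncomm_ring) -hj
      rw [this]
      exact two_mul_mem (mul_base_mem (baseComm_mem x y k l))

theorem comm_x_mem (h : IsWeakPair J x y) {w : R} (hw : w ∈ reducedSpan K x y) :
    comm w x ∈ reducedSpan K x y :=
  comm_mem_of_generators (fun k l j => h.comm_generator_mem k l j (h.comm_baseComm_x_mem k l)
    (h.comm_baseComm_mul_base_mem k l).1) hw

/-- A long commutator in `x, y` lies in the reduced span and preserves it under right
multiplication. -/
theorem leftNormed_mem (h : IsWeakPair J x y) {L : List R} (hL : 2 ≤ L.length)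
    (hxy : ∀ z ∈ L, z = x ∨ z = y) :
    leftNormed L ∈ reducedSpan K x y ∧
      ∀ s ∈ reducedSpan K x y, s * leftNormed L ∈ reducedSpan K x y := by
  have key : ∀ (M : List R) (w : R), (∀ z ∈ M, z = x ∨ z = y) →
      (w ∈ reducedSpan K x y ∧ ∀ s ∈ reducedSpan K x y, s * w ∈ reducedSpan K x y) →
      (M.foldl comm w ∈ reducedSpan K x y ∧
        ∀ s ∈ reducedSpan K x y, s * M.foldl comm w ∈ reducedSpan K x y) := by
    intro M
    induction M with
    | nil => intro w _ hw; exact hw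
    | cons z M ih =>
      intro w hM hw
      have hz : ∀ v ∈ reducedSpan K x y, comm v z ∈ reducedSpan K x y := by
        intro v hv
        rcases hM z (by simp) with rfl | rfl
        · exact h.comm_x_mem hv
        · exact h.comm_y_mem hv
      refine ih _ (fun t ht => hM t (by simp [ht])) ⟨hz w hw.1, fun s hs => ?_⟩
      -- The Leibniz rule reduces multiplication by `[w, z]` to multiplication by `w` and stability
      -- under `ad z`.
      have e : s * comm w z = comm (s * w) z - comm s z * w := by
        rw [comm_mul_left]; abel
      rw [e]
      exact sub_mem (hz _ (hw.2 s hs)) (hw.2 _ (hz s hs))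
  obtain _ | ⟨a, _ | ⟨b, M⟩⟩ := L
  · simp at hL
  · simp at hL
  have hbase : comm y x ∈ reducedSpan K x y := baseComm_mem x y 0 0
  have hneg : comm x y = - comm y x := by unfold comm; abel
  refine key M (comm a b) (fun z hz => hxy z (by simp [hz])) ?_
  rcases hxy a (by simp) with rfl | rfl <;> rcases hxy b (by simp) with rfl | rfl
  · simp [comm]
  · rw [hneg]
    exact ⟨neg_mem hbase, fun s hs => by rw [mul_neg]; exact neg_mem (mul_base_mem hs)⟩
  · exact ⟨hbase, fun s hs => mul_base_mem hs⟩
  · simp [comm]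

theorem prod_leftNormed_mem (h : IsWeakPair J x y) (L : List (List R))
    (hL : ∀ M ∈ L, 2 ≤ M.length ∧ ∀ z ∈ M, z = x ∨ z = y) :
    (L.map leftNormed).prod ∈ Submodule.span K {1} ⊔ reducedSpan K x y := by
  have key : ∀ s ∈ Submodule.span K {1} ⊔ reducedSpan K x y,
      s * (L.map leftNormed).prod ∈ Submodule.span K {1} ⊔ reducedSpan K x y := by
    induction L with
    | nil => simp
    | cons M L ih =>
      intro s hs
      rw [List.map_cons, List.prod_cons, ← mul_assoc]
      apply ih (fun N hN => hL N (by simp [hN]))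
      obtain ⟨hM, hM'⟩ := h.leftNormed_mem (hL M (by simp)).1 (hL M (by simp)).2
      obtain ⟨t, ht, w, hw, rfl⟩ := Submodule.mem_sup.mp hs
      obtain ⟨r, rfl⟩ := Submodule.mem_span_singleton.mp ht
      rw [add_mul, smul_mul_assoc, one_mul]
      exact Submodule.mem_sup_right (add_mem (Submodule.smul_mem _ r hM) (hM' w hw))
  simpa using key 1 (Submodule.mem_sup_left (Submodule.mem_span_singleton_self 1))

end IsWeakPair
end Reduced

/-! ### Commutators under ring homomorphisms -/

theorem map_comm {R S : Type*} [Ring R] [Ring S] (f : R →+* S) (a b : R) :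
    f (comm a b) = comm (f a) (f b) := by simp [comm]

theorem map_jordan {R S : Type*} [Ring R] [Ring S] (f : R →+* S) (a b : R) :
    f (jordan a b) = jordan (f a) (f b) := by simp [jordan]

theorem map_iterate_ad {R S : Type*} [Ring R] [Ring S] (f : R →+* S) (z v : R) (k : ℕ) :
    f ((ad z)^[k] v) = (ad (f z))^[k] (f v) := by
  induction k with
  | zero => rfl
  | succ k ih => simp only [Function.iterate_succ_apply', ad, map_comm, ← ih]

theorem map_foldl_comm {R S : Type*} [Ring R] [Ring S] (f : R →+* S) (L : List R) (a : R) :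
    f (L.foldl comm a) = (L.map f).foldl comm (f a) := by
  induction L generalizing a with
  | nil => rfl
  | cons b L ih => simp [ih, map_comm]

theorem map_leftNormed {R S : Type*} [Ring R] [Ring S] (f : R →+* S) (L : List R) :
    f (leftNormed L) = leftNormed (L.map f) := by
  cases L with
  | nil => simp [leftNormed]
  | cons a L => exact map_foldl_comm f L a

theorem foldl_comm_replicate {R : Type*} [Ring R] (z a : R) (k : ℕ) :
    (List.replicate k z).foldl comm a = (ad z)^[k] a := by
  induction k generalizing a with
  | zero => rfl
  | succ k ih => rw [List.replicate_succ, List.foldl_cons, ih, Function.iterate_succ_apply]; rfl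

/-! ### Transfer to the relatively free algebra -/

variable (K : Type*) [Field K]

theorem XInf_mem_SJ (i : ℕ) : XInf K i ∈ SJ K :=
  Submodule.mem_sInf.mpr fun _ hS => hS.2.1 i

theorem zero_mem_SJ : (0 : AInf K) ∈ SJ K := zero_mem _

theorem jordan_mem_SJ {a b : AInf K} (ha : a ∈ SJ K) (hb : b ∈ SJ K) : jordan a b ∈ SJ K :=
  Submodule.mem_sInf.mpr fun S hS =>
    hS.2.2 a (Submodule.mem_sInf.mp ha S hS) b (Submodule.mem_sInf.mp hb S hS)

theorem lift_metab (u : ℕ → AInf K) :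
    FreeAlgebra.lift K u (metab K) = comm (comm (u 0) (u 1)) (comm (u 2) (u 3)) := by
  simp [metab, comm, XInf]

theorem sum_sign_perm_four {R : Type*} [Ring R] (g : ℕ → R) :
    ∑ σ : Equiv.Perm (Fin 4), ((Equiv.Perm.sign σ : ℤ) : R) *
      (g (σ 0) * g (σ 1) * g (σ 2) * g (σ 3)) =
      jordan (comm (g 0) (g 1)) (comm (g 2) (g 3)) -
        jordan (comm (g 0) (g 2)) (comm (g 1) (g 3)) +
        jordan (comm (g 0) (g 3)) (comm (g 1) (g 2)) := by
  rw [Finset.univ_perm_fin_succ, Finset.sum_map, ← Finset.univ_product_univ, Finset.sum_product]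
  simp only [Finset.univ_perm_fin_succ, Finset.sum_map, ← Finset.univ_product_univ,
    Finset.sum_product, Fin.sum_univ_four, Fin.sum_univ_three, Fin.sum_univ_two,
    Finset.univ_unique, Finset.sum_singleton]
  -- The literals `2` and `3` must be read as successors before the recursive description of the
  -- permutation applies.
  have e2 (p : Fin 4) (σ : Equiv.Perm (Fin 3)) :
      Equiv.Perm.decomposeFin.symm (p, σ) 2 = Equiv.swap 0 p (σ 1).succ :=
    Equiv.Perm.decomposeFin_symm_apply_succ σ p 1
  have e3 (p : Fin 4) (σ : Equiv.Perm (Fin 3)) :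
      Equiv.Perm.decomposeFin.symm (p, σ) 3 = Equiv.swap 0 p (σ 2).succ :=
    Equiv.Perm.decomposeFin_symm_apply_succ σ p 2
  have e2' (p : Fin 3) (σ : Equiv.Perm (Fin 2)) :
      Equiv.Perm.decomposeFin.symm (p, σ) 2 = Equiv.swap 0 p (σ 1).succ :=
    Equiv.Perm.decomposeFin_symm_apply_succ σ p 1
  simp [Equiv.Perm.decomposeFin.symm_sign, Equiv.swap_apply_def, e2, e3, e2']
  unfold comm jordan
  noncomm_ring

theorem lift_S4 (u : ℕ → AInf K) :
    FreeAlgebra.lift K u (S4 K) =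
      jordan (comm (u 0) (u 1)) (comm (u 2) (u 3)) -
        jordan (comm (u 0) (u 2)) (comm (u 1) (u 3)) +
        jordan (comm (u 0) (u 3)) (comm (u 1) (u 2)) := by
  have h : FreeAlgebra.lift K u (S4 K) = ∑ σ : Equiv.Perm (Fin 4),
      ((Equiv.Perm.sign σ : ℤ) : AInf K) * (u (σ 0) * u (σ 1) * u (σ 2) * u (σ 3)) := by
    simp [S4, XInf]
  rw [h, sum_sign_perm_four]

/-- The image in `F_m` of the elements of `A_m` that lie in the free special Jordan algebra. -/
def jordanImage (m : ℕ) : Submodule K (F K m) :=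
  ((SJ K).comap (incl K m).toLinearMap).map (proj K m).toLinearMap

theorem proj_eq_zero {m : ℕ} {a : A K m} (h : incl K m a ∈ T K) : proj K m a = 0 := by
  have h1 : a ∈ Tm K m := (TwoSidedIdeal.mem_comap (incl K m)).mpr h
  rw [TwoSidedIdeal.mem_iff] at h1
  exact ((Tm K m).ringCon.eq).mpr h1

theorem proj_surjective (m : ℕ) : Function.Surjective (proj K m) :=
  RingCon.mk'_surjective _

theorem lift_mem_T {f : AInf K} (hf : f = S4 K ∨ f = metab K) {u : ℕ → AInf K}
    (hu : ∀ j, u j ∈ SJ K) : FreeAlgebra.lift K u f ∈ T K :=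
  TwoSidedIdeal.subset_span ⟨f, hf, u, hu, rfl⟩

/-- The sequence `a, b, c, d, 0, 0, …`. -/
def fourSeq {R : Type*} [Zero R] (a b c d : R) : ℕ → R
  | 0 => a
  | 1 => b
  | 2 => c
  | 3 => d
  | _ => 0

theorem fourSeq_mem {a b c d : AInf K} (ha : a ∈ SJ K) (hb : b ∈ SJ K) (hc : c ∈ SJ K)
    (hd : d ∈ SJ K) : ∀ j, fourSeq a b c d j ∈ SJ K
  | 0 => ha
  | 1 => hb
  | 2 => hc
  | 3 => hd
  | _ + 4 => zero_mem_SJ K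

theorem isWeakPair_proj :
    IsWeakPair (jordanImage K 2) (proj K 2 (X K 0)) (proj K 2 (X K 1)) where
  mem_x := ⟨X K 0, by simpa [incl, X] using XInf_mem_SJ K 0, rfl⟩
  mem_y := ⟨X K 1, by simpa [incl, X] using XInf_mem_SJ K 1, rfl⟩
  jordan_mem := by
    rintro _ ⟨a, ha, rfl⟩ _ ⟨b, hb, rfl⟩
    refine ⟨jordan a b, ?_, map_jordan (proj K 2 : A K 2 →+* F K 2) a b⟩
    have := jordan_mem_SJ K ha hb
    simpa [jordan] using this
  metab := by
    rintro _ ⟨a, ha, rfl⟩ _ ⟨b, hb, rfl⟩ _ ⟨c, hc, rfl⟩ _ ⟨d, hd, rfl⟩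
    have h := lift_mem_T K (Or.inr rfl) (fourSeq_mem K ha hb hc hd)
    rw [lift_metab] at h
    have h2 : proj K 2 (comm (comm a b) (comm c d)) = 0 :=
      proj_eq_zero K (by simpa [comm, fourSeq] using h)
    simpa [comm] using h2
  s4 := by
    rintro _ ⟨a, ha, rfl⟩ _ ⟨b, hb, rfl⟩ _ ⟨c, hc, rfl⟩ _ ⟨d, hd, rfl⟩
    have h := lift_mem_T K (Or.inl rfl) (fourSeq_mem K ha hb hc hd)
    rw [lift_S4] at h
    have h2 : proj K 2 (jordan (comm a b) (comm c d) - jordan (comm a c) (comm b d) +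
        jordan (comm a d) (comm b c)) = 0 :=
      proj_eq_zero K (by simpa [comm, jordan, fourSeq] using h)
    simpa [comm, jordan] using h2
  central := by
    intro z hx hy r
    -- The images of `x` and `y` generate `F_2`, so commuting with both suffices.
    obtain ⟨a, rfl⟩ := proj_surjective K 2 r
    induction a using FreeAlgebra.induction with
    | grade0 t => rw [AlgHom.commutes]; exact (Algebra.commutes t z).symm
    | grade1 i => fin_cases i <;> assumption
    | mul a b ha hb => rw [map_mul, ← mul_assoc, ha, mul_assoc, hb, mul_assoc]
    | add a b ha hb => rw [map_add, mul_add, add_mul, ha, hb]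

theorem proj_elt {m : ℕ} (x y : A K m) (k l q : ℕ) :
    proj K m (elt x y k l q) =
      baseComm (proj K m x) (proj K m y) k l * comm (proj K m y) (proj K m x) ^ (q - 1) := by
  have h := map_iterate_ad (proj K m : A K m →+* F K m)
  have h' := map_comm (proj K m : A K m →+* F K m)
  simp only [RingHom.coe_coe] at h h'
  simp only [elt, baseComm, map_mul, map_pow, h, h']

theorem elt_mem_B (k l q : ℕ) : elt (X K (0 : Fin 2)) (X K 1) k l q ∈ B K 2 := by
  let L : List (List (Fin 2)) :=
    (1 :: 0 :: (List.replicate k 0 ++ List.replicate l 1)) :: List.replicate (q - 1) [1, 0]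
  refine Submodule.mem_iSup_of_mem (L.map List.length).sum
    (Submodule.subset_span ⟨L, ?_, rfl, ?_⟩)
  · intro c hc
    rcases List.mem_cons.mp hc with rfl | hc
    · simp
    · rw [List.eq_of_mem_replicate hc]; simp
  · simp [L, elt, leftNormed, foldl_comm_replicate]

end WeakId

/-! ### The spanning theorem -/

theorem proposition7 (K : Type*) [Field K] [CharZero K] :
    WeakId.Btilde K 2 = Submodule.span K
      ({1} ∪ {f : WeakId.F K 2 | ∃ k l q : ℕ, 1 ≤ q ∧
        f = WeakId.proj K 2 (WeakId.elt (WeakId.X K 0) (WeakId.X K 1) k l q)}) := by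
  open WeakId in
  apply le_antisymm
  · rw [Btilde, B, Submodule.map_iSup]
    refine iSup_le fun n => ?_
    rw [Bdeg, Submodule.map_span_le]
    rintro _ ⟨L, hL, -, rfl⟩
    have h := (isWeakPair_proj K).prod_leftNormed_mem
      (L.map fun c => c.map fun i => proj K 2 (X K i)) (by
        intro M hM
        obtain ⟨c, hc, rfl⟩ := List.mem_map.mp hM
        refine ⟨by simpa using hL c hc, fun z hz => ?_⟩
        obtain ⟨i, -, rfl⟩ := List.mem_map.mp hz
        fin_cases i
        · exact Or.inl rfl
        · exact Or.inr rfl)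
    have e : (proj K 2) (L.map fun c => leftNormed (c.map (X K))).prod =
        ((L.map fun c => c.map fun i => proj K 2 (X K i)).map leftNormed).prod := by
      have h' := map_leftNormed (proj K 2 : A K 2 →+* F K 2)
      simp only [RingHom.coe_coe] at h'
      rw [map_list_prod, List.map_map, List.map_map]
      congr 1
      refine List.map_congr_left fun c _ => ?_
      simp only [Function.comp_apply, h', List.map_map]
      rfl
    rw [AlgHom.toLinearMap_apply, e, Submodule.span_union]
    have hle : reducedSpan K (proj K 2 (X K 0)) (proj K 2 (X K 1)) ≤ Submodule.span K
        {f : F K 2 | ∃ k l q : ℕ, 1 ≤ q ∧ f = proj K 2 (elt (X K 0) (X K 1) k l q)} := by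
      refine Submodule.span_mono ?_
      rintro _ ⟨k, l, j, rfl⟩
      exact ⟨k, l, j + 1, by simp, by simp [proj_elt]⟩
    have hsup := sup_le_sup_left hle (Submodule.span K {1})
    exact hsup h
  · rw [Submodule.span_le]
    rintro _ (rfl | ⟨k, l, q, -, rfl⟩)
    · exact ⟨1, Submodule.mem_iSup_of_mem 0 (Submodule.subset_span ⟨[], by simp⟩), map_one (proj K 2)⟩
    · exact ⟨_, elt_mem_B K k l q, rfl⟩
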